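/- Let $(\epsilon_t)_{t\in\mathbb Z}$ be iid real random variables with mean $0$ and variance $1$, and let $X=(X_t)_{t\in\mathbb Z}$ be an augmented GARCH($a,b$) process, $a\ge 1$, $b\ge 0$: $X_t=\sigma_t\epsilon_t$ with $\sigma_t\ge 0$ and $$\Lambda(\sigma_t^2)=\sum_{i=1}^{a} g_i(\epsilon_{t-i})+\sum_{j=1}^{b} c_j(\epsilon_{t-j})\,\Lambda(\sigma_{t-j}^2),$$ where $\Lambda,g_i,c_j$ are real-valued measurable functions. Assume that $\Lambda,g_i,c_j$ are chosen such that $\sigma_t^2=\sigma^2>0$ is a positive constant (the same for all $t$). Let $r\ge 1$ be an integer and $p\in(0,1)$. Let $F_X$ be the distribution function of $X_0$, $f_X=F_X'$, $q_X(p)=\inf\{x\in\mathbb R: F_X(x)\ge p\}$ and $m(X,r)=\mathbb E|X_0-\mathbb E X_0|^r$. Write $\|\cdot\|_s$ for the $L_s$-norm. Assume: (i) if $r=1$, $F_X$ is continuous at $0$; (ii) $F_X$ is twice differentiable at $q_X(p)$ and $f_X(q_X(p))>0$; (iii) $\mathbb E|\epsilon_0|^{2r}<\infty$; (iv) $g_i\ge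 0$ and $c_j\ge 0$ for $i=1,\dots,a$, $j=1,\dots,b$; (v) either $\Lambda(x)=x^\delta$ for some $\delta>0$ and, with $s=\max(1,r/\delta)$, $\sum_{i=1}^a\|g_i(\epsilon_0)\|_s<\infty$ and $\sum_{j=1}^b\|c_j(\epsilon_0)\|_s<1$; or $\Lambda(x)=\log x$, $\mathbb E\big[\exp\big(4r\sum_{i=1}^a|g_i(\epsilon_0)|^2\big)\big]<\infty$ and $\sum_{j=1}^b|c_j(\epsilon_0)|<1$ almost surely. For a sample $X_1,\dots,X_n$ with order statistics $X_{(1)}\le\dots\le X_{(n)}$ and mean $\bar X_n$, put $q_n(p)=X_{(\lceil np\rceil)}$ and $\hat m(X,n,r)=\frac1n\sum_{i=1}^n|X_i-\bar X_n|^r$. Then the random variables $X_t$, $t\in\mathbb Z$, are iid, and $$\sqrt n\begin{pmatrix} q_n(p)-q_X(p)\\ \hat m(X,n,r)-m(X,r)\end{pmatrix}\xrightarrow[n\to\infty]{d}\mathcal N(0,\Gamma),$$ where $\Gamma$ is the (positive semidefinite) symmetric $2\times2$ matrix with entries, writing $\kappa_r=\mathbb E[X_0^{r-1}\operatorname{sgn}(X_0)^r]$,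 $$\Gamma_{11}=\frac{p(1-p)}{f_X^2(q_X(p))},\qquad \Gamma_{22}=r^2\kappa_r^2\,\sigma^2+\operatorname{Var}(|X_0|^r)-2r\,\kappa_r\operatorname{Cov}(X_0,|X_0|^r),$$ $$\Gamma_{12}=\Gamma_{21}=\frac{1}{f_X(q_X(p))}\Big(r\,\kappa_r\operatorname{Cov}\big(\mathbf 1_{\{X_0\le q_X(p)\}},X_0\big)-\operatorname{Cov}\big(\mathbf 1_{\{X_0\le q_X(p)\}},|X_0|^r\big)\Big).$$ -/

import Mathlib

open MeasureTheory ProbabilityTheory Filter Topology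

noncomputable section

namespace AugGARCH

/-- `X` is an augmented GARCH(`a`, `b`) process with innovations `ε`, volatilities `σ`, transform `Λ`
and coefficient functions `g 1, …, g a` and `c 1, …, c b` (the other values of `g`, `c` are
irrelevant):
`X_t = σ_t ε_t` and `Λ(σ_t²) = ∑_{i=1}^a g_i(ε_{t-i}) + ∑_{j=1}^b c_j(ε_{t-j}) Λ(σ_{t-j}²)`. -/
structure IsAugmentedGARCH {Ω : Type*} [MeasurableSpace Ω] (P : Measure Ω) (a b : ℕ)
    (Λ : ℝ → ℝ) (g c : ℕ → ℝ → ℝ) (ε σ X : ℤ → Ω → ℝ) : Prop where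
  one_le_order : 1 ≤ a
  measurable_transform : Measurable Λ
  measurable_g : ∀ i ∈ Finset.Icc 1 a, Measurable (g i)
  measurable_c : ∀ j ∈ Finset.Icc 1 b, Measurable (c j)
  measurable_innovation : ∀ t, Measurable (ε t)
  measurable_volatility : ∀ t, Measurable (σ t)
  measurable_process : ∀ t, Measurable (X t)
  /-- the innovations are iid with mean `0` and variance `1` -/
  indep_innovation : iIndepFun ε P
  identDistrib_innovation : ∀ t, IdentDistrib (ε t) (ε 0) P P
  memLp_innovation : MemLp (ε 0) 2 P
  mean_innovation : ∫ ω, ε 0 ω ∂P = 0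
  variance_innovation : Var[ε 0; P] = 1
  /-- the volatility is the nonnegative square root of `σ_t²` -/
  volatility_nonneg : ∀ t, ∀ᵐ ω ∂P, 0 ≤ σ t ω
  process_eq : ∀ t, ∀ᵐ ω ∂P, X t ω = σ t ω * ε t ω
  volatility_eq : ∀ t : ℤ, ∀ᵐ ω ∂P,
    Λ (σ t ω ^ 2) = ∑ i ∈ Finset.Icc 1 a, g i (ε (t - (i : ℤ)) ω)
      + ∑ j ∈ Finset.Icc 1 b, c j (ε (t - (j : ℤ)) ω) * Λ (σ (t - (j : ℤ)) ω ^ 2)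

/-- Polynomial transform `Λ(x) = x ^ δ`, `δ > 0` (on its domain `x ≥ 0`). -/
def IsPolynomial (Λ : ℝ → ℝ) (δ : ℝ) : Prop :=
  0 < δ ∧ ∀ x, 0 ≤ x → Λ x = x ^ δ

/-- Exponential transform `Λ(x) = log x` (on its domain `x > 0`). -/
def IsExponential (Λ : ℝ → ℝ) : Prop :=
  ∀ x, 0 < x → Λ x = Real.log x

/-- Condition `(A)`: the coefficient functions are nonnegative. -/
def CondA (a b : ℕ) (g c : ℕ → ℝ → ℝ) : Prop :=
  (∀ i ∈ Finset.Icc 1 a, ∀ x, 0 ≤ g i x) ∧ (∀ j ∈ Finset.Icc 1 b, ∀ x, 0 ≤ c j x)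

/-- Condition `(M_r)`: `E[|ε_0|^{2r}] < ∞`. -/
def CondM {Ω : Type*} [MeasurableSpace Ω] (P : Measure Ω) (ε : ℤ → Ω → ℝ) (r : ℕ) : Prop :=
  Integrable (fun ω => |ε 0 ω| ^ (2 * r)) P

/-- Condition `(P_s)` for a real exponent `s`:
`∑ ‖g_i(ε_0)‖_s < ∞` and `∑ ‖c_j(ε_0)‖_s < 1`. -/
def CondP {Ω : Type*} [MeasurableSpace Ω] (P : Measure Ω) (a b : ℕ) (g c : ℕ → ℝ → ℝ)
    (ε : ℤ → Ω → ℝ) (s : ℝ) : Prop :=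
  (∑ i ∈ Finset.Icc 1 a, eLpNorm (fun ω => g i (ε 0 ω)) (ENNReal.ofReal s) P < ⊤) ∧
  (∑ j ∈ Finset.Icc 1 b, eLpNorm (fun ω => c j (ε 0 ω)) (ENNReal.ofReal s) P < 1)

/-- Condition `(L_r)`: `E[exp(4r ∑ |g_i(ε_0)|²)] < ∞` and `∑ |c_j(ε_0)| < 1` almost surely. -/
def CondL {Ω : Type*} [MeasurableSpace Ω] (P : Measure Ω) (a b : ℕ) (g c : ℕ → ℝ → ℝ)
    (ε : ℤ → Ω → ℝ) (r : ℕ) : Prop :=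
  Integrable (fun ω => Real.exp (4 * r * ∑ i ∈ Finset.Icc 1 a, |g i (ε 0 ω)| ^ 2)) P ∧
  ∀ᵐ ω ∂P, ∑ j ∈ Finset.Icc 1 b, |c j (ε 0 ω)| < 1

/-- The cumulative distribution function `F_Y` of a real random variable `Y`. -/
def distFun {Ω : Type*} [MeasurableSpace Ω] (P : Measure Ω) (Y : Ω → ℝ) : ℝ → ℝ :=
  fun x => cdf (P.map Y) x

/-- The density `f_Y = F_Y'` (meaningful at points where `F_Y` is differentiable). -/
def density {Ω : Type*} [MeasurableSpace Ω] (P : Measure Ω) (Y : Ω → ℝ) : ℝ → ℝ :=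
  deriv (distFun P Y)

/-- The quantile `q_Y(p) = inf {x : F_Y(x) ≥ p}`. -/
def quantile {Ω : Type*} [MeasurableSpace Ω] (P : Measure Ω) (Y : Ω → ℝ) (p : ℝ) : ℝ :=
  sInf {x : ℝ | p ≤ distFun P Y x}

/-- `F` is twice differentiable at `x`. -/
def TwiceDifferentiableAt (F : ℝ → ℝ) (x : ℝ) : Prop :=
  (∀ᶠ y in 𝓝 x, DifferentiableAt ℝ F y) ∧ DifferentiableAt ℝ (deriv F) x

/-- The absolute centred moment `m(Y, r) = E[|Y - E Y| ^ r]`. -/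
def absCentredMoment {Ω : Type*} [MeasurableSpace Ω] (P : Measure Ω) (Y : Ω → ℝ) (r : ℕ) : ℝ :=
  ∫ ω, |Y ω - ∫ ω', Y ω' ∂P| ^ r ∂P

/-- The `k`-th smallest entry `x_(k)`, `1 ≤ k ≤ n`, of the sample `x` (and `0` for other `k`). -/
def orderStat {n : ℕ} (x : Fin n → ℝ) (k : ℕ) : ℝ :=
  if h : 1 ≤ k ∧ k ≤ n then x (Tuple.sort x ⟨k - 1, by omega⟩) else 0

/-- The sample quantile `q_n(p) = x_(⌈n p⌉)`. -/
def sampleQuantile {n : ℕ} (x : Fin n → ℝ) (p : ℝ) : ℝ :=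
  orderStat x ⌈(n : ℝ) * p⌉₊

/-- The empirical mean. -/
def sampleMean {n : ℕ} (x : Fin n → ℝ) : ℝ :=
  (1 / (n : ℝ)) * ∑ i, x i

/-- The absolute centred sample moment `(1/n) ∑ |x_i - x̄| ^ r`. -/
def sampleAbsCentredMoment {n : ℕ} (x : Fin n → ℝ) (r : ℕ) : ℝ :=
  (1 / (n : ℝ)) * ∑ i, |x i - sampleMean x| ^ r

/-- The sample `(X_1, …, X_n)`. -/
def sample {Ω : Type*} (X : ℤ → Ω → ℝ) (n : ℕ) (ω : Ω) : Fin n → ℝ :=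
  fun i => X ((i : ℤ) + 1) ω

/-- `E[Y^{r-1} sgn(Y)^r]` (for `r ≥ 1`). -/
def signedMoment {Ω : Type*} [MeasurableSpace Ω] (P : Measure Ω) (Y : Ω → ℝ) (r : ℕ) : ℝ :=
  ∫ ω, Y ω ^ (r - 1) * Real.sign (Y ω) ^ r ∂P

/-- The indicator `1{Y ≤ q}`. -/
def indLe {Ω : Type*} (Y : Ω → ℝ) (q : ℝ) : Ω → ℝ :=
  Set.indicator {ω | Y ω ≤ q} (fun _ => 1)

/-- `Γ₁₁ = p (1 - p) / f²(q)` with `q = q_Y(p)`. -/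
def gamma11 {Ω : Type*} [MeasurableSpace Ω] (P : Measure Ω) (Y : Ω → ℝ) (p : ℝ) : ℝ :=
  p * (1 - p) / density P Y (quantile P Y p) ^ 2

/-- `Γ₂₂ = r² E[Y^{r-1} sgn(Y)^r]² v + Var(|Y|^r) - 2 r E[Y^{r-1} sgn(Y)^r] Cov(Y, |Y|^r)`. -/
def gamma22 {Ω : Type*} [MeasurableSpace Ω] (P : Measure Ω) (Y : Ω → ℝ) (v : ℝ) (r : ℕ) : ℝ :=
  (r : ℝ) ^ 2 * signedMoment P Y r ^ 2 * v + Var[fun ω => |Y ω| ^ r; P]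
    - 2 * r * signedMoment P Y r * cov[Y, fun ω => |Y ω| ^ r; P]

/-- `Γ₁₂ = (r E[Y^{r-1} sgn(Y)^r] Cov(1{Y ≤ q}, Y) - Cov(1{Y ≤ q}, |Y|^r)) / f(q)`
with `q = q_Y(p)`. -/
def gamma12 {Ω : Type*} [MeasurableSpace Ω] (P : Measure Ω) (Y : Ω → ℝ) (p : ℝ) (r : ℕ) : ℝ :=
  1 / density P Y (quantile P Y p) *
    (r * signedMoment P Y r * cov[indLe Y (quantile P Y p), Y; P]
      - cov[indLe Y (quantile P Y p), fun ω => |Y ω| ^ r; P])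

/-- The asymptotic covariance matrix `Γ`. -/
def gammaMatrix {Ω : Type*} [MeasurableSpace Ω] (P : Measure Ω) (Y : Ω → ℝ) (v p : ℝ) (r : ℕ) :
    Matrix (Fin 2) (Fin 2) ℝ :=
  !![gamma11 P Y p, gamma12 P Y p r; gamma12 P Y p r, gamma22 P Y v r]

end AugGARCH

end

namespace AugGARCH

/-! Constant volatility forces `X t = √v * ε t` almost surely, so the process is iid and centred
with variance `v` and a finite absolute moment of order `2r`. What remains is a joint central limit
theorem for an iid sample.

Up to an error vanishing in probability, each statistic is a normalized sum of influence functions.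
For the quantile (`tendsto_measure_sampleQuantile_sub`), bounding the sample quantile amounts to
bounding an empirical count. Increments of the empirical process over windows of width of order
`1/√n` are negligible, the derivative of the distribution function linearizes the drift, and Ghosh's
lemma (`tendsto_measure_abs_sub_ge_of_crossing`) turns this comparison of events into convergence in
probability.

For the moment (`tendsto_measure_sampleAbsCentredMoment_sub`), `|x|^r` is convex with subgradient `r
* signedPow r x`. Monotonicity of the subgradient bounds the linearization error uniformly over
shifts of order `1/√n`, and the mean of that bound tends to zero by dominated convergence. When `r =
1` the subgradient jumps at `0`; continuity of the distribution function there excludes an atom at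
the jump.

The two influence functions form a centred square-integrable vector with covariance `Γ`
(`gammaMatrix_eq_covariance`). The multivariate central limit theorem and Slutsky's lemma conclude.
-/

variable {Ω : Type*} [MeasurableSpace Ω] {P : Measure Ω} [IsProbabilityMeasure P]

/-! ### Multivariate central limit theorem and Chebyshev bound for iid sums -/

section CentralLimit

variable {ι : Type*} [Fintype ι]

lemma variance_linear_combination {W : ι → Ω → ℝ} (hW : ∀ i, MemLp (W i) 2 P) (t : ι → ℝ) :
    Var[fun ω => ∑ i, t i * W i ω; P]
      = t ⬝ᵥ (Matrix.of fun i j => cov[W i, W j; P]).mulVec t := by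
  rw [variance_fun_sum fun i => (hW i).const_mul (t i)]
  simp only [covariance_const_mul_left, covariance_const_mul_right, dotProduct, Matrix.mulVec,
    Matrix.of_apply, Finset.mul_sum]
  refine Finset.sum_congr rfl fun i _ => Finset.sum_congr rfl fun j _ => by ring

lemma posSemidef_covariance {W : ι → Ω → ℝ} (hW : ∀ i, MemLp (W i) 2 P) :
    (Matrix.of fun i j => cov[W i, W j; P]).PosSemidef := by
  refine Matrix.PosSemidef.of_dotProduct_mulVec_nonneg ?_ fun t => ?_
  · ext i j
    simp [covariance_comm]
  · simpa using (variance_linear_combination hW t).symm ▸ variance_nonneg _ P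

omit [IsProbabilityMeasure P] in
lemma aemeasurable_normalized_sum {Z : ℕ → Ω → EuclideanSpace ℝ ι}
    (hZ : ∀ k, AEMeasurable (Z k) P) (n : ℕ) :
    AEMeasurable (fun ω => (√(n : ℝ))⁻¹ • ∑ k ∈ Finset.range n, Z k ω) P := by
  have : AEMeasurable (fun ω => ∑ k ∈ Finset.range n, Z k ω) P :=
    Finset.aemeasurable_fun_sum _ fun k _ => hZ k
  exact this.const_smul ((√(n : ℝ))⁻¹)

-- The Cramér–Wold device: a multivariate characteristic function at `t` is that of a
-- one-dimensional projection at `1`, so the scalar limit is only needed at the point `1`.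
omit [IsProbabilityMeasure P] in
lemma charFun_map_inner {E : Type*} [NormedAddCommGroup E] [InnerProductSpace ℝ E]
    [MeasurableSpace E] [BorelSpace E] [SecondCountableTopology E] {S : Ω → E}
    (hS : AEMeasurable S P) (t : E) :
    charFun (P.map S) t = charFun (P.map fun ω => inner ℝ (S ω) t) 1 := by
  rw [charFun_apply, charFun_apply, integral_map hS (by fun_prop),
    integral_map (by fun_prop) (by fun_prop)]
  simp

/-- The central limit theorem for centred variables, in terms of characteristic functions. -/
lemma tendsto_charFun_normalized_sum_real {T : ℕ → Ω → ℝ} {T₀ : Ω → ℝ}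
    (hindep : iIndepFun T P) (hident : ∀ k, IdentDistrib (T k) T₀ P P)
    (hL2 : MemLp T₀ 2 P) (hmean : ∫ ω, T₀ ω ∂P = 0) :
    Tendsto (fun n : ℕ => charFun (P.map fun ω =>
      (√(n : ℝ))⁻¹ * ∑ k ∈ Finset.range n, T k ω) 1) atTop
      (𝓝 (Complex.exp (-(Var[T₀; P] : ℂ) / 2))) := by
  have hclt := tendstoInDistribution_inv_sqrt_mul_sum_sub
    (P' := gaussianReal 0 Var[T 0; P].toNNReal) (Y := id)
    ⟨aemeasurable_id, Measure.map_id⟩ ((hident 0).memLp_iff.2 hL2) hindep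
    (fun k => (hident k).trans (hident 0).symm)
  have hmean0 : ∫ ω, T 0 ω ∂P = 0 := (hident 0).integral_eq.trans hmean
  have hchar := ProbabilityMeasure.tendsto_iff_tendsto_charFun.1 hclt.tendsto 1
  simp only [ProbabilityMeasure.coe_mk, Measure.map_id, hmean0, mul_zero, sub_zero] at hchar
  convert hchar using 2
  rw [charFun_gaussianReal, (hident 0).variance_eq, Real.coe_toNNReal _ (variance_nonneg _ P)]
  simp [neg_div]

lemma tendsto_charFun_normalized_sum [DecidableEq ι]
    {Z : ℕ → Ω → EuclideanSpace ℝ ι} {Z₀ : Ω → EuclideanSpace ℝ ι}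
    (hindep : iIndepFun Z P) (hident : ∀ k, IdentDistrib (Z k) Z₀ P P)
    (hL2 : ∀ i, MemLp (fun ω => Z₀ ω i) 2 P) (hmean : ∀ i, ∫ ω, Z₀ ω i ∂P = 0)
    (t : EuclideanSpace ℝ ι) :
    Tendsto (fun n : ℕ => charFun (P.map fun ω => (√(n : ℝ))⁻¹ • ∑ k ∈ Finset.range n, Z k ω) t)
      atTop (𝓝 (charFun (multivariateGaussian 0
        (Matrix.of fun i j => cov[fun ω => Z₀ ω i, fun ω => Z₀ ω j; P])) t)) := by
  have hinner (z : EuclideanSpace ℝ ι) : inner ℝ z t = ∑ i, t i * z i := by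
    simp [PiLp.inner_apply]
  have hm : Measurable fun z : EuclideanSpace ℝ ι => inner ℝ z t := by fun_prop
  have hT k : IdentDistrib (fun ω => inner ℝ (Z k ω) t) (fun ω => inner ℝ (Z₀ ω) t) P P :=
    (hident k).comp hm
  have hT2 : MemLp (fun ω => inner ℝ (Z₀ ω) t) 2 P := by
    simp only [hinner]
    exact memLp_finsetSum _ fun i _ => (hL2 i).const_mul (t i)
  have hTmean : ∫ ω, inner ℝ (Z₀ ω) t ∂P = 0 := by
    simp only [hinner]
    rw [integral_finsetSum _ fun i _ => ((hL2 i).integrable (by norm_num)).const_mul (t i)]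
    simp [integral_const_mul, hmean]
  have hvar : Var[fun ω => inner ℝ (Z₀ ω) t; P] = t.ofLp ⬝ᵥ
      (Matrix.of fun i j => cov[fun ω => Z₀ ω i, fun ω => Z₀ ω j; P]).mulVec t.ofLp := by
    simp only [hinner]
    exact variance_linear_combination hL2 _
  have hS (n : ℕ) : AEMeasurable (fun ω => (√(n : ℝ))⁻¹ • ∑ k ∈ Finset.range n, Z k ω) P :=
    aemeasurable_normalized_sum (fun k => (hident k).aemeasurable_fst) n
  have hindepT : iIndepFun (fun k ω => inner ℝ (Z k ω) t) P :=
    hindep.comp (fun _ z => inner ℝ z t) fun _ => hm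
  rw [charFun_multivariateGaussian (posSemidef_covariance hL2), ← hvar]
  convert tendsto_charFun_normalized_sum_real hindepT hT hT2 hTmean using 2 with n
  · rw [charFun_map_inner (hS n)]
    simp only [real_inner_smul_left, sum_inner]
  · simp [neg_div]

/-- The multivariate central limit theorem for centred iid vectors. -/
theorem tendstoInDistribution_multivariateGaussian [DecidableEq ι]
    {Z : ℕ → Ω → EuclideanSpace ℝ ι} {Z₀ : Ω → EuclideanSpace ℝ ι}
    (hindep : iIndepFun Z P) (hident : ∀ k, IdentDistrib (Z k) Z₀ P P)
    (hL2 : ∀ i, MemLp (fun ω => Z₀ ω i) 2 P) (hmean : ∀ i, ∫ ω, Z₀ ω i ∂P = 0) :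
    TendstoInDistribution (fun (n : ℕ) ω => (√(n : ℝ))⁻¹ • ∑ k ∈ Finset.range n, Z k ω) atTop
      (fun z : EuclideanSpace ℝ ι => z) (fun _ => P)
      (multivariateGaussian 0
        (Matrix.of fun i j => cov[fun ω => Z₀ ω i, fun ω => Z₀ ω j; P])) where
  forall_aemeasurable n :=
    aemeasurable_normalized_sum (fun k => (hident k).aemeasurable_fst) n
  aemeasurable_limit := aemeasurable_id
  tendsto := by
    refine ProbabilityMeasure.tendsto_iff_tendsto_charFun.2 fun t => ?_
    simp only [ProbabilityMeasure.coe_mk, Measure.map_id']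
    exact tendsto_charFun_normalized_sum hindep hident hL2 hmean t

/-- Chebyshev's inequality for normalized sums of centred iid variables. -/
lemma measure_normalized_sum_ge_le {Z : ℕ → Ω → ℝ} {Z₀ : Ω → ℝ}
    (hindep : iIndepFun Z P) (hident : ∀ k, IdentDistrib (Z k) Z₀ P P)
    (hL2 : MemLp Z₀ 2 P) (hmean : ∫ ω, Z₀ ω ∂P = 0) (n : ℕ) {δ : ℝ} (hδ : 0 < δ) :
    P.real {ω | δ ≤ |(√(n : ℝ))⁻¹ * ∑ k ∈ Finset.range n, Z k ω|} ≤ Var[Z₀; P] / δ ^ 2 := by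
  have hL2k k : MemLp (Z k) 2 P := (hident k).memLp_iff.2 hL2
  have hs : MemLp (fun ω => (√(n : ℝ))⁻¹ * ∑ k ∈ Finset.range n, Z k ω) 2 P :=
    (memLp_finsetSum _ fun k _ => hL2k k).const_mul _
  have hint : ∫ ω, (√(n : ℝ))⁻¹ * ∑ k ∈ Finset.range n, Z k ω ∂P = 0 := by
    rw [integral_const_mul, integral_finsetSum _ fun k _ => (hL2k k).integrable (by norm_num)]
    simp [(hident _).integral_eq, hmean]
  have hvar : Var[fun ω => (√(n : ℝ))⁻¹ * ∑ k ∈ Finset.range n, Z k ω; P] ≤ Var[Z₀; P] := by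
    rw [variance_const_mul]
    have := IndepFun.variance_sum (s := Finset.range n) (fun k _ => hL2k k)
      fun i _ j _ hij => hindep.indepFun hij
    rw [show (fun ω => ∑ k ∈ Finset.range n, Z k ω) = ∑ k ∈ Finset.range n, Z k by
      ext; simp, this]
    simp only [(hident _).variance_eq, Finset.sum_const, Finset.card_range, nsmul_eq_mul]
    rcases n.eq_zero_or_pos with rfl | hn
    · simp [variance_nonneg]
    · rw [← mul_assoc, inv_pow, Real.sq_sqrt (by positivity), inv_mul_cancel₀ (by positivity),
        one_mul]
  have h := meas_ge_le_variance_div_sq hs hδ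
  rw [hint] at h
  simp only [sub_zero] at h
  refine (ENNReal.toReal_le_of_le_ofReal
    (div_nonneg (variance_nonneg _ P) (sq_nonneg δ)) h).trans ?_
  gcongr

end CentralLimit

/-! ### Tightness and the crossing criterion -/

/-- Uniform tightness of a sequence of real random variables. -/
def IsTightSeq (P : Measure Ω) (W : ℕ → Ω → ℝ) : Prop :=
  ∀ η > 0, ∃ M > 0, ∀ n, P.real {ω | M ≤ |W n ω|} ≤ η

lemma isTightSeq_normalized_sum {Z : ℕ → Ω → ℝ} {Z₀ : Ω → ℝ}
    (hindep : iIndepFun Z P) (hident : ∀ k, IdentDistrib (Z k) Z₀ P P)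
    (hL2 : MemLp Z₀ 2 P) (hmean : ∫ ω, Z₀ ω ∂P = 0) :
    IsTightSeq P fun (n : ℕ) ω => (√(n : ℝ))⁻¹ * ∑ k ∈ Finset.range n, Z k ω := by
  intro η hη
  have h0 := variance_nonneg Z₀ P
  -- Chebyshev gives the bound `Var / M ^ 2`, so `M ^ 2 ≥ Var / η` is wanted; the added `1` keeps
  -- `M` positive when the variance vanishes.
  refine ⟨√(Var[Z₀; P] / η + 1), by positivity, fun n =>
    (measure_normalized_sum_ge_le hindep hident hL2 hmean n (by positivity)).trans ?_⟩
  rw [Real.sq_sqrt (by positivity), div_le_iff₀ (by positivity)]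
  have : η * (Var[Z₀; P] / η) = Var[Z₀; P] := by field_simp
  linarith

/-- Ghosh's lemma: a criterion for `V - W → 0` in probability in terms of crossing events. -/
theorem tendsto_measure_abs_sub_ge_of_crossing {V W : ℕ → Ω → ℝ} (hW : IsTightSeq P W)
    (hup : ∀ y z, y < z → Tendsto (fun n => P.real {ω | V n ω ≤ y ∧ z ≤ W n ω}) atTop (𝓝 0))
    (hdown : ∀ y z, y < z → Tendsto (fun n => P.real {ω | z < V n ω ∧ W n ω ≤ y}) atTop (𝓝 0))
    {ε : ℝ} (hε : 0 < ε) :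
    Tendsto (fun n => P.real {ω | ε ≤ |V n ω - W n ω|}) atTop (𝓝 0) := by
  refine Metric.tendsto_atTop'.2 fun η hη => ?_
  obtain ⟨M, hM, hMW⟩ := hW (η / 2) (by positivity)
  -- A discrepancy `ε` spans three cells of mesh `d`, so a full cell separates `V` from `W` wherever
  -- `W` sits in the grid. Where `|W| < M`, only finitely many cells matter; the `+ 2` in `N` leaves
  -- room for neighbouring cells.
  set d := ε / 3 with hd
  have hdpos : 0 < d := by positivity
  set N : ℤ := ⌈M / d⌉ + 2
  have hsum : Tendsto (fun n => ∑ j ∈ Finset.Icc (-N) N,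
      (P.real {ω | V n ω ≤ j * d ∧ j * d + d ≤ W n ω}
        + P.real {ω | j * d + d < V n ω ∧ W n ω ≤ j * d})) atTop (𝓝 0) := by
    rw [← Finset.sum_const_zero (s := Finset.Icc (-N) N)]
    refine tendsto_finsetSum _ fun j _ => ?_
    rw [← add_zero (0 : ℝ)]
    exact (hup _ _ (by linarith)).add (hdown _ _ (by linarith))
  obtain ⟨n₀, hn₀⟩ := eventually_atTop.1 (hsum.eventually_lt_const (half_pos hη))
  refine ⟨n₀, fun n hn => ?_⟩
  rw [Real.dist_eq, sub_zero, abs_of_nonneg measureReal_nonneg]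
  have hsub : {ω | ε ≤ |V n ω - W n ω|} ⊆ {ω | M ≤ |W n ω|} ∪
      ⋃ j ∈ Finset.Icc (-N) N, ({ω | V n ω ≤ j * d ∧ j * d + d ≤ W n ω}
        ∪ {ω | j * d + d < V n ω ∧ W n ω ≤ j * d}) := by
    intro ω hω
    by_cases hWM : M ≤ |W n ω|
    · exact Or.inl hWM
    right
    rw [not_le, abs_lt] at hWM
    have hMd : M / d * d = M := by field_simp
    have hNM : M + 2 * d ≤ N * d := by
      have := Int.le_ceil (M / d)
      have h2 : (M / d + 2) * d ≤ N * d := by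
        gcongr
        push_cast [N]
        linarith
      linarith
    have hWd : W n ω / d * d = W n ω := by field_simp
    simp only [Set.mem_iUnion, Finset.mem_Icc, exists_prop]
    rcases le_abs'.1 (show ε ≤ |V n ω - W n ω| from hω) with h | h
    · set k := ⌊W n ω / d⌋
      have h1 : (k : ℝ) * d ≤ W n ω := by
        rw [← hWd]; gcongr; exact Int.floor_le _
      have h2 : W n ω < (k + 1) * d := by
        rw [← hWd]; gcongr; exact Int.lt_floor_add_one _
      refine ⟨k - 1, ⟨?_, ?_⟩, Or.inl ⟨?_, ?_⟩⟩
      · have : (-N : ℝ) * d < (k : ℝ) * d := by linarith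
        have := lt_of_mul_lt_mul_right this hdpos.le
        have : -N < k := by exact_mod_cast this
        omega
      · have : (k : ℝ) * d < N * d := by linarith
        have := lt_of_mul_lt_mul_right this hdpos.le
        have : k < N := by exact_mod_cast this
        omega
      · push_cast; linarith
      · push_cast; linarith
    · set k := ⌈W n ω / d⌉
      have h1 : W n ω ≤ (k : ℝ) * d := by
        rw [← hWd]; gcongr; exact Int.le_ceil _
      have h2 : ((k : ℝ) - 1) * d < W n ω := by
        rw [← hWd]; gcongr; linarith [Int.ceil_lt_add_one (W n ω / d)]
      refine ⟨k, ⟨?_, ?_⟩, Or.inr ⟨?_, h1⟩⟩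
      · have : (-N : ℝ) * d < (k : ℝ) * d := by linarith
        have := lt_of_mul_lt_mul_right this hdpos.le
        have : -N < k := by exact_mod_cast this
        omega
      · have : (k : ℝ) * d < N * d := by linarith
        have := lt_of_mul_lt_mul_right this hdpos.le
        have : k < N := by exact_mod_cast this
        omega
      · linarith
  calc P.real {ω | ε ≤ |V n ω - W n ω|}
      ≤ P.real {ω | M ≤ |W n ω|} + ∑ j ∈ Finset.Icc (-N) N,
        (P.real {ω | V n ω ≤ j * d ∧ j * d + d ≤ W n ω}
          + P.real {ω | j * d + d < V n ω ∧ W n ω ≤ j * d}) := by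
        refine (measureReal_mono hsub).trans ((measureReal_union_le _ _).trans ?_)
        gcongr
        refine (measureReal_biUnion_finset_le _ _).trans (Finset.sum_le_sum fun j _ => ?_)
        exact measureReal_union_le _ _
    _ < η := by linarith [hMW n, hn₀ n hn.le]

/-! ### Order statistics through counting -/

section OrderStatistics

/-- Counting entries below `y` is insensitive to the sorting permutation, and for a sorted sample
those entries form an initial segment. Zero-based indexing turns `k - 1 < card` into `k ≤ card`. -/
lemma orderStat_le_iff {n k : ℕ} (x : Fin n → ℝ) (hk : 1 ≤ k) (hkn : k ≤ n) (y : ℝ) :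
    orderStat x k ≤ y ↔ k ≤ (Finset.univ.filter fun i => x i ≤ y).card := by
  rw [orderStat, dif_pos ⟨hk, hkn⟩]
  have h := Tuple.lt_card_le_iff_apply_le_of_monotone (j := ⟨k - 1, by omega⟩) (a := y)
    (Tuple.monotone_sort x)
  have hcard : (Finset.univ.filter fun i => (x ∘ Tuple.sort x) i ≤ y).card
      = (Finset.univ.filter fun i => x i ≤ y).card :=
    Finset.card_equiv (Tuple.sort x) (by simp)
  rw [hcard] at h
  rw [← Function.comp_apply (f := x), ← h]
  simp only
  omega

/-- Since `0 < p < 1`, the rank `⌈n p⌉` lies between `1` and `n`, so the default value of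
`orderStat` never occurs; the count being an integer, the ceiling can be dropped. -/
lemma sampleQuantile_le_iff {n : ℕ} (hn : 1 ≤ n) {p : ℝ} (hp : p ∈ Set.Ioo (0 : ℝ) 1)
    (x : Fin n → ℝ) (y : ℝ) :
    sampleQuantile x p ≤ y ↔ n * p ≤ ∑ i, if x i ≤ y then (1 : ℝ) else 0 := by
  have hn0 : (0 : ℝ) < n := by exact_mod_cast hn
  rw [sampleQuantile, orderStat_le_iff, Nat.ceil_le]
  · simp
  · exact Nat.one_le_iff_ne_zero.2 (Nat.ceil_pos.2 (mul_pos hn0 hp.1)).ne'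
  · exact Nat.ceil_le.2 (by nlinarith [hp.2])

lemma measurable_sampleQuantile {p : ℝ} (hp : p ∈ Set.Ioo (0 : ℝ) 1) (n : ℕ) :
    Measurable fun x : Fin n → ℝ => sampleQuantile x p := by
  rcases n.eq_zero_or_pos with rfl | hn
  · exact Subsingleton.measurable
  refine measurable_of_Iic fun y => ?_
  simp only [Set.preimage, Set.mem_Iic, sampleQuantile_le_iff hn hp]
  refine measurableSet_le measurable_const (Finset.measurable_sum _ fun i _ => ?_)
  exact Measurable.ite (measurableSet_le (measurable_pi_apply i) measurable_const)
    measurable_const measurable_const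

end OrderStatistics

/-! ### Bahadur representation of the sample quantile -/

section Quantile

lemma measurable_indicator_Iic (u : ℝ) :
    Measurable ((Set.Iic u).indicator fun _ : ℝ => (1 : ℝ)) :=
  measurable_const.indicator measurableSet_Iic

lemma integral_indicator_Iic {Y : Ω → ℝ} (hY : AEMeasurable Y P) (u : ℝ) :
    ∫ ω, (Set.Iic u).indicator (fun _ => (1 : ℝ)) (Y ω) ∂P = distFun P Y u := by
  have := Measure.isProbabilityMeasure_map hY
  rw [distFun, cdf_eq_real,
    ← integral_map hY (measurable_indicator_Iic u).aestronglyMeasurable,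
    integral_indicator measurableSet_Iic]
  simp

lemma memLp_indicator_Iic {Y : Ω → ℝ} (hY : AEMeasurable Y P) (u : ℝ) :
    MemLp (fun ω => (Set.Iic u).indicator (fun _ => (1 : ℝ)) (Y ω)) 2 P := by
  refine MemLp.of_bound ((measurable_indicator_Iic u).comp_aemeasurable hY).aestronglyMeasurable 1
    (ae_of_all _ fun ω => ?_)
  by_cases h : Y ω ∈ Set.Iic u <;> simp [h]

/-- For `q ≤ u` the difference is itself an indicator, hence equal to its square, and its mean is
the increment of the distribution function. -/
lemma variance_indicator_Iic_sub_le {Y : Ω → ℝ} (hY : AEMeasurable Y P) (u q : ℝ) :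
    Var[fun ω => (Set.Iic u).indicator (fun _ => (1 : ℝ)) (Y ω)
      - (Set.Iic q).indicator (fun _ => (1 : ℝ)) (Y ω); P]
      ≤ |distFun P Y u - distFun P Y q| := by
  wlog h : q ≤ u generalizing u q
  · have := this q u (not_le.1 h).le
    rw [abs_sub_comm, ← variance_fun_neg]
    simpa only [neg_sub] using this
  have hint (x : ℝ) := (memLp_indicator_Iic hY x).integrable (by norm_num)
  refine (variance_le_expectation_sq
    ((memLp_indicator_Iic hY u).sub (memLp_indicator_Iic hY q)).aestronglyMeasurable).trans ?_
  rw [← integral_indicator_Iic hY, ← integral_indicator_Iic hY, ← integral_sub (hint u) (hint q)]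
  refine le_trans (le_of_eq (integral_congr_ae (ae_of_all _ fun ω => ?_))) (le_abs_self _)
  rcases le_or_gt (Y ω) q with h1 | h1
  · simp [h1, h1.trans h]
  · rcases le_or_gt (Y ω) u with h2 | h2
    · simp [h1, h2]
    · simp [h1, h2]

omit [IsProbabilityMeasure P] in
/-- The distribution function takes the value `p` at the `p`-quantile if it is continuous there. -/
lemma distFun_quantile {Y : Ω → ℝ} {p : ℝ} (hp : p ∈ Set.Ioo (0 : ℝ) 1)
    (hcont : ContinuousAt (distFun P Y) (quantile P Y p)) :
    distFun P Y (quantile P Y p) = p := by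
  set q := quantile P Y p with hq
  have hmono : Monotone (distFun P Y) := monotone_cdf _
  obtain ⟨x₀, hx₀⟩ := ((tendsto_cdf_atBot (P.map Y)).eventually_lt_const hp.1).exists
  obtain ⟨x₁, hx₁⟩ := ((tendsto_cdf_atTop (P.map Y)).eventually_const_lt hp.2).exists
  have hne : {x : ℝ | p ≤ distFun P Y x}.Nonempty := ⟨x₁, hx₁.le⟩
  have hbdd : BddBelow {x : ℝ | p ≤ distFun P Y x} :=
    ⟨x₀, fun x hx => le_of_lt (hmono.reflect_lt (lt_of_lt_of_le hx₀ hx))⟩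
  apply le_antisymm
  · refine le_of_tendsto (hcont.tendsto.mono_left (nhdsWithin_le_nhds (s := Set.Iio q))) ?_
    filter_upwards [self_mem_nhdsWithin] with x hx
    exact (not_le.1 fun h => (not_le.2 hx) (csInf_le hbdd h)).le
  · refine ge_of_tendsto (hcont.tendsto.mono_left (nhdsWithin_le_nhds (s := Set.Ioi q))) ?_
    filter_upwards [self_mem_nhdsWithin] with x hx
    obtain ⟨y, hy, hyx⟩ := exists_lt_of_csInf_lt hne hx
    exact le_trans hy (hmono hyx.le)

lemma tendsto_sqrt_natCast : Tendsto (fun n : ℕ => √(n : ℝ)) atTop atTop :=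
  Real.tendsto_sqrt_atTop.comp tendsto_natCast_atTop_atTop

lemma tendsto_add_inv_sqrt_mul (x y : ℝ) :
    Tendsto (fun n : ℕ => x + (√(n : ℝ))⁻¹ * y) atTop (𝓝 x) := by
  simpa using ((tendsto_inv_atTop_zero.comp tendsto_sqrt_natCast).mul_const y).const_add x

variable {Y : ℕ → Ω → ℝ} {Y₀ : Ω → ℝ}

/-- By Chebyshev the probability is at most the increment of the distribution function over the
shrinking window, divided by `δ ^ 2`; continuity at `q` sends it to zero. -/
lemma tendsto_measure_empirical_increment (hindep : iIndepFun Y P)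
    (hident : ∀ k, IdentDistrib (Y k) Y₀ P P) {q : ℝ} (hcont : ContinuousAt (distFun P Y₀) q)
    (y : ℝ) {δ : ℝ} (hδ : 0 < δ) :
    Tendsto (fun n : ℕ => P.real {ω | δ ≤ |(√(n : ℝ))⁻¹ * ∑ k ∈ Finset.range n,
      (((Set.Iic (q + (√(n : ℝ))⁻¹ * y)).indicator (fun _ => (1 : ℝ)) (Y k ω)
        - (Set.Iic q).indicator (fun _ => (1 : ℝ)) (Y k ω))
        - (distFun P Y₀ (q + (√(n : ℝ))⁻¹ * y) - distFun P Y₀ q))|}) atTop (𝓝 0) := by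
  have hY₀ := (hident 0).aemeasurable_snd
  have hlim : Tendsto (fun n : ℕ => |distFun P Y₀ (q + (√(n : ℝ))⁻¹ * y) - distFun P Y₀ q| / δ ^ 2)
      atTop (𝓝 0) := by
    have h := hcont.tendsto.comp (tendsto_add_inv_sqrt_mul q y)
    simpa using ((h.sub_const (distFun P Y₀ q)).abs).div_const (δ ^ 2)
  refine squeeze_zero (fun _ => measureReal_nonneg) (fun n => ?_) hlim
  set u := q + (√(n : ℝ))⁻¹ * y
  set f : ℝ → ℝ := fun x => ((Set.Iic u).indicator (fun _ => (1 : ℝ)) x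
        - (Set.Iic q).indicator (fun _ => (1 : ℝ)) x) - (distFun P Y₀ u - distFun P Y₀ q) with hf
  have hfm : Measurable f :=
    ((measurable_indicator_Iic u).sub (measurable_indicator_Iic q)).sub_const _
  have hL2 : MemLp (fun ω => (Set.Iic u).indicator (fun _ => (1 : ℝ)) (Y₀ ω)
      - (Set.Iic q).indicator (fun _ => (1 : ℝ)) (Y₀ ω)) 2 P :=
    (memLp_indicator_Iic hY₀ u).sub (memLp_indicator_Iic hY₀ q)
  have hint (x : ℝ) := (memLp_indicator_Iic hY₀ x).integrable (q := 2) (by norm_num)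
  have hmean : ∫ ω, (f ∘ Y₀) ω ∂P = 0 := by
    simp only [hf, Function.comp_apply]
    rw [integral_sub (hL2.integrable (by norm_num)) (integrable_const _),
      integral_sub (hint u) (hint q), integral_indicator_Iic hY₀, integral_indicator_Iic hY₀]
    simp
  refine (measure_normalized_sum_ge_le (hindep.comp (fun _ => f) fun _ => hfm)
    (fun k => (hident k).comp hfm) (hL2.sub (memLp_const _)) hmean n hδ).trans ?_
  gcongr
  refine le_trans (le_of_eq ?_) (variance_indicator_Iic_sub_le hY₀ u q)
  exact variance_sub_const hL2.aestronglyMeasurable _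

/-- The weak Bahadur representation of the sample quantile. -/
theorem tendsto_measure_sampleQuantile_sub (hindep : iIndepFun Y P)
    (hident : ∀ k, IdentDistrib (Y k) Y₀ P P) {p q d : ℝ} (hp : p ∈ Set.Ioo (0 : ℝ) 1)
    (hderiv : HasDerivAt (distFun P Y₀) d q) (hFq : distFun P Y₀ q = p) (hd : 0 < d)
    {ε : ℝ} (hε : 0 < ε) :
    Tendsto (fun n : ℕ => P.real {ω | ε ≤
      |√(n : ℝ) * (sampleQuantile (fun i : Fin n => Y i ω) p - q)
        - (√(n : ℝ))⁻¹ * ∑ k ∈ Finset.range n,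
          -((Set.Iic q).indicator (fun _ => (1 : ℝ)) (Y k ω) - p) / d|}) atTop (𝓝 0) := by
  have hY₀ := (hident 0).aemeasurable_snd
  have hfm : Measurable fun x : ℝ => -((Set.Iic q).indicator (fun _ => (1 : ℝ)) x - p) / d :=
    (((measurable_indicator_Iic q).sub_const p).neg).div_const d
  have hmean : ∫ ω, -((Set.Iic q).indicator (fun _ => (1 : ℝ)) (Y₀ ω) - p) / d ∂P = 0 := by
    rw [integral_div, integral_neg, integral_sub ((memLp_indicator_Iic hY₀ q).integrable
      (by norm_num)) (integrable_const _), integral_indicator_Iic hY₀, hFq]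
    simp
  have hL2 : MemLp (fun ω => -((Set.Iic q).indicator (fun _ => (1 : ℝ)) (Y₀ ω) - p) / d) 2 P := by
    simp only [div_eq_mul_inv]
    exact (((memLp_indicator_Iic hY₀ q).sub (memLp_const p)).neg).mul_const d⁻¹
  set W : ℕ → Ω → ℝ := fun n ω => (√(n : ℝ))⁻¹ * ∑ k ∈ Finset.range n,
    -((Set.Iic q).indicator (fun _ => (1 : ℝ)) (Y k ω) - p) / d with hW
  set b : ℝ → ℕ → ℝ := fun y n => √(n : ℝ) * (distFun P Y₀ (q + (√(n : ℝ))⁻¹ * y) - p) with hb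
  set D : ℝ → ℕ → Ω → ℝ := fun y n ω => (√(n : ℝ))⁻¹ * ∑ k ∈ Finset.range n,
      (((Set.Iic (q + (√(n : ℝ))⁻¹ * y)).indicator (fun _ => (1 : ℝ)) (Y k ω)
        - (Set.Iic q).indicator (fun _ => (1 : ℝ)) (Y k ω))
        - (distFun P Y₀ (q + (√(n : ℝ))⁻¹ * y) - distFun P Y₀ q)) with hD
  -- The drift `b y n` is `y` times a difference quotient of the distribution function at `q`.
  have hblim (y : ℝ) : Tendsto (b y) atTop (𝓝 (d * y)) := by
    have h := hderiv.hasFDerivAt.lim y (c := fun n : ℕ => √(n : ℝ)) (l := atTop)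
      (tendsto_norm_atTop_atTop.comp tendsto_sqrt_natCast)
    simpa [hFq, mul_comm y d] using h
  have hDlim (y : ℝ) {δ : ℝ} (hδ : 0 < δ) :
      Tendsto (fun n => P.real {ω | δ ≤ |D y n ω|}) atTop (𝓝 0) :=
    tendsto_measure_empirical_increment hindep hident hderiv.continuousAt y hδ
  -- After centring and scaling, the empirical count splits into the negligible fluctuation `D`, the
  -- drift `b` and the value at `q`, which is `-d * W`. A crossing thus forces `D` to bridge a gap
  -- close to `d * (z - y)`.
  have hcross (y : ℝ) (n : ℕ) (hn : 1 ≤ n) (ω : Ω) :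
      √(n : ℝ) * (sampleQuantile (fun i : Fin n => Y i ω) p - q) ≤ y ↔
        0 ≤ D y n ω + b y n - d * W n ω := by
    have hs : 0 < √(n : ℝ) := Real.sqrt_pos.2 (by exact_mod_cast hn)
    have hn' : (n : ℝ) = √(n : ℝ) * √(n : ℝ) := (Real.mul_self_sqrt (by positivity)).symm
    have h1 : √(n : ℝ) * (sampleQuantile (fun i : Fin n => Y i ω) p - q) ≤ y ↔
        sampleQuantile (fun i : Fin n => Y i ω) p ≤ q + (√(n : ℝ))⁻¹ * y := by
      rw [← le_inv_mul_iff₀ hs, sub_le_iff_le_add']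
    rw [h1, sampleQuantile_le_iff hn hp]
    have h2 : (∑ i : Fin n, if Y i ω ≤ q + (√(n : ℝ))⁻¹ * y then (1 : ℝ) else 0)
        = ∑ k ∈ Finset.range n,
          (Set.Iic (q + (√(n : ℝ))⁻¹ * y)).indicator (fun _ => (1 : ℝ)) (Y k ω) := by
      rw [Finset.sum_range]
      simp [Set.indicator_apply]
    have h3 : D y n ω + b y n - d * W n ω = (√(n : ℝ))⁻¹ * (∑ k ∈ Finset.range n,
        (Set.Iic (q + (√(n : ℝ))⁻¹ * y)).indicator (fun _ => (1 : ℝ)) (Y k ω) - n * p) := by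
      simp only [hD, hb, hW, Finset.sum_sub_distrib, ← Finset.sum_div, Finset.sum_neg_distrib,
        Finset.sum_const, Finset.card_range, nsmul_eq_mul, hFq]
      generalize (∑ k ∈ Finset.range n,
        (Set.Iic (q + (√(n : ℝ))⁻¹ * y)).indicator (fun _ => (1 : ℝ)) (Y k ω)) = A
      generalize distFun P Y₀ (q + (√(n : ℝ))⁻¹ * y) = B
      generalize √(n : ℝ) = s at *
      rw [hn']
      field_simp
      ring
    rw [h2, h3, mul_nonneg_iff_of_pos_left (by positivity), sub_nonneg]
  refine tendsto_measure_abs_sub_ge_of_crossing (isTightSeq_normalized_sum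
    (hindep.comp (fun _ => _) fun _ => hfm) (fun k => (hident k).comp hfm) hL2 hmean) ?_ ?_ hε
  · intro y z hyz
    -- Half of the gap absorbs the error of `b y n` as an approximation of `d * y`; the other half
    -- is left for `D`.
    have hδ : 0 < d * (z - y) / 2 := by have := sub_pos.2 hyz; positivity
    refine squeeze_zero' (Eventually.of_forall fun _ => measureReal_nonneg) ?_ (hDlim y hδ)
    filter_upwards [(hblim y).eventually_lt_const (show d * y < d * y + d * (z - y) / 2 by linarith),
      eventually_ge_atTop 1] with n hbn hn
    refine measureReal_mono fun ω hω => ?_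
    have h1 := (hcross y n hn ω).1 hω.1
    have h2 : d * z ≤ d * W n ω := mul_le_mul_of_nonneg_left hω.2 hd.le
    refine le_trans ?_ (le_abs_self (D y n ω))
    linarith
  · intro y z hyz
    have hδ : 0 < d * (z - y) / 2 := by have := sub_pos.2 hyz; positivity
    refine squeeze_zero' (Eventually.of_forall fun _ => measureReal_nonneg) ?_ (hDlim z hδ)
    filter_upwards [(hblim z).eventually_const_lt (show d * z - d * (z - y) / 2 < d * z by linarith),
      eventually_ge_atTop 1] with n hbn hn
    refine measureReal_mono fun ω hω => ?_
    have h1 := (not_congr (hcross z n hn ω)).1 (not_le.2 hω.1)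
    have h2 : d * W n ω ≤ d * y := mul_le_mul_of_nonneg_left hω.2 hd.le
    refine le_trans ?_ (neg_le_abs (D z n ω))
    linarith

end Quantile

/-! ### Convexity of the absolute power -/

noncomputable section SignedPower

/-- The subgradient `x^{r-1} sgn(x)^r` of `|x|^r / r`. -/
def signedPow (r : ℕ) (x : ℝ) : ℝ := x ^ (r - 1) * Real.sign x ^ r

lemma measurable_sign : Measurable Real.sign := by
  unfold Real.sign
  exact Measurable.ite measurableSet_Iio measurable_const
    (Measurable.ite measurableSet_Ioi measurable_const measurable_const)

lemma measurable_signedPow (r : ℕ) : Measurable (signedPow r) :=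
  (measurable_id.pow_const _).mul (measurable_sign.pow_const _)

lemma signedPow_neg {r : ℕ} (hr : 1 ≤ r) (x : ℝ) : signedPow r (-x) = -signedPow r x := by
  obtain ⟨k, rfl⟩ : ∃ k, r = k + 1 := ⟨r - 1, by omega⟩
  rw [signedPow, signedPow, Real.sign_neg, neg_pow, neg_pow (Real.sign x), Nat.add_sub_cancel,
    pow_succ (-1 : ℝ) k]
  rcases neg_one_pow_eq_or ℝ k with h | h <;> rw [h] <;> ring

lemma signedPow_of_pos (r : ℕ) {x : ℝ} (hx : 0 < x) : signedPow r x = x ^ (r - 1) := by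
  simp [signedPow, Real.sign_of_pos hx]

lemma signedPow_zero {r : ℕ} (hr : 1 ≤ r) : signedPow r 0 = 0 := by
  simp [signedPow, show r ≠ 0 by omega]

lemma abs_signedPow_le (r : ℕ) (x : ℝ) : |signedPow r x| ≤ |x| ^ (r - 1) := by
  rw [signedPow, abs_mul, abs_pow, abs_pow]
  refine mul_le_of_le_one_right (by positivity) (pow_le_one₀ (abs_nonneg _) ?_)
  rcases Real.sign_apply_eq x with h | h | h <;> simp [h]

/-- By the symmetry `x ↦ -x` one may take `x ≥ 0`. For `x > 0` this is Bernoulli's inequality for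
the ratio `|y| / x`, multiplied by `x ^ r`, together with `y ≤ |y|`. -/
lemma subgradient_abs_pow {r : ℕ} (hr : 1 ≤ r) (x y : ℝ) :
    |x| ^ r + r * signedPow r x * (y - x) ≤ |y| ^ r := by
  wlog hx : 0 ≤ x generalizing x y
  · have := this (-x) (-y) (by linarith)
    rw [abs_neg, abs_neg, signedPow_neg hr] at this
    linarith
  rcases hx.eq_or_lt with rfl | hx
  · rw [signedPow_zero hr]
    simp [show r ≠ 0 by omega]
  rw [signedPow_of_pos r hx, abs_of_pos hx]
  obtain ⟨k, rfl⟩ : ∃ k, r = k + 1 := ⟨r - 1, by omega⟩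
  have hb := one_add_mul_sub_le_pow (a := |y| / x)
    (by linarith [div_nonneg (abs_nonneg y) hx.le]) (k + 1)
  have h1 : x ^ (k + 1) * (1 + ((k + 1 : ℕ) : ℝ) * (|y| / x - 1)) ≤ |y| ^ (k + 1) := by
    calc _ ≤ x ^ (k + 1) * (|y| / x) ^ (k + 1) := by gcongr
      _ = |y| ^ (k + 1) := by rw [← mul_pow, mul_div_cancel₀ _ hx.ne']
  have h2 : x ^ (k + 1) * (1 + ((k + 1 : ℕ) : ℝ) * (|y| / x - 1))
      = x ^ (k + 1) + ((k + 1 : ℕ) : ℝ) * x ^ k * (|y| - x) := by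
    rw [pow_succ]; field_simp
  rw [h2] at h1
  refine le_trans ?_ h1
  rw [Nat.add_sub_cancel]
  gcongr
  exact le_abs_self y

/-- Adding the subgradient inequalities at `x` and at `y` cancels the powers. -/
lemma monotone_signedPow {r : ℕ} (hr : 1 ≤ r) : Monotone (signedPow r) := by
  intro x y hxy
  rcases hxy.eq_or_lt with rfl | hxy
  · rfl
  have h1 := subgradient_abs_pow hr x y
  have h2 := subgradient_abs_pow hr y x
  have hr0 : (0 : ℝ) < r := by exact_mod_cast hr
  have h3 : 0 ≤ (r * (y - x)) * (signedPow r y - signedPow r x) := by linarith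
  have h4 : 0 < r * (y - x) := mul_pos hr0 (sub_pos.2 hxy)
  linarith [nonneg_of_mul_nonneg_right h3 h4]

lemma continuousAt_signedPow {r : ℕ} {x : ℝ} (h : r = 1 → x ≠ 0) (hr : 1 ≤ r) :
    ContinuousAt (signedPow r) x := by
  by_cases hx : x = 0
  · subst hx
    have hr1 : r - 1 ≠ 0 := by have : r ≠ 1 := fun h' => h h' rfl; omega
    rw [ContinuousAt, signedPow_zero hr]
    refine squeeze_zero_norm (fun y => abs_signedPow_le r y) ?_
    have : Tendsto (fun y : ℝ => |y| ^ (r - 1)) (𝓝 0) (𝓝 (|0| ^ (r - 1))) :=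
      (continuous_abs.pow _).tendsto 0
    simpa [hr1] using this
  · refine ContinuousAt.mul (by fun_prop) (ContinuousAt.pow ?_ _)
    rcases lt_or_gt_of_ne hx with hx | hx
    · refine continuousAt_const.congr (f := fun _ => (-1 : ℝ)) ?_
      filter_upwards [Iio_mem_nhds hx] with y hy using (Real.sign_of_neg hy).symm
    · refine continuousAt_const.congr (f := fun _ => (1 : ℝ)) ?_
      filter_upwards [Ioi_mem_nhds hx] with y hy using (Real.sign_of_pos hy).symm

/-- The linearization error of `h ↦ |x - h|^r` at `0`. -/
def absPowRemainder (r : ℕ) (x h : ℝ) : ℝ := |x - h| ^ r - |x| ^ r + r * h * signedPow r x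

/-- The subgradient at `x` makes the remainder nonnegative; the one at `x - h` bounds it by `r h`
times an increment of `signedPow`. Monotonicity replaces that increment by one over `[x - δ, x +
δ]`, free of the random shift `h`. -/
lemma abs_absPowRemainder_le {r : ℕ} (hr : 1 ≤ r) (x : ℝ) {h δ : ℝ} (hδ : |h| ≤ δ) :
    |absPowRemainder r x h| ≤ r * δ * (signedPow r (x + δ) - signedPow r (x - δ)) := by
  have h1 := subgradient_abs_pow hr x (x - h)
  have h2 := subgradient_abs_pow hr (x - h) x
  have hle := abs_le.1 hδ
  have hδ0 : 0 ≤ δ := (abs_nonneg h).trans hδ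
  have hm := monotone_signedPow hr
  have ha : |signedPow r x - signedPow r (x - h)| ≤ signedPow r (x + δ) - signedPow r (x - δ) := by
    have e1 := hm (show x ≤ x + δ by linarith)
    have e2 := hm (show x - δ ≤ x by linarith)
    have e3 := hm (show x - h ≤ x + δ by linarith)
    have e4 := hm (show x - δ ≤ x - h by linarith)
    rw [abs_le]; constructor <;> linarith
  rw [absPowRemainder, abs_of_nonneg (by linarith)]
  calc _ ≤ r * (h * (signedPow r x - signedPow r (x - h))) := by linarith
    _ ≤ r * (δ * (signedPow r (x + δ) - signedPow r (x - δ))) := by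
      refine mul_le_mul_of_nonneg_left ((le_abs_self _).trans ?_) (Nat.cast_nonneg r)
      rw [abs_mul]
      exact mul_le_mul hδ ha (abs_nonneg _) hδ0
    _ = _ := by ring

end SignedPower

/-! ### Linearization of the absolute centred sample moment -/

section Moments

lemma memLp_abs_pow {Y : Ω → ℝ} (hY : AEMeasurable Y P) {r : ℕ}
    (hint : Integrable (fun ω => |Y ω| ^ (2 * r)) P) {k : ℕ} (hk : k ≤ r) :
    MemLp (fun ω => |Y ω| ^ k) 2 P := by
  have hm : AEStronglyMeasurable (fun ω => |Y ω| ^ k) P :=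
    (((continuous_abs.pow k).measurable).comp_aemeasurable hY).aestronglyMeasurable
  rw [memLp_two_iff_integrable_sq hm]
  refine ((integrable_const (1 : ℝ)).add hint).mono' (hm.pow 2) (ae_of_all _ fun ω => ?_)
  rw [← pow_mul, mul_comm k 2, Real.norm_of_nonneg (by positivity)]
  change |Y ω| ^ (2 * k) ≤ 1 + |Y ω| ^ (2 * r)
  rcases le_total (|Y ω|) 1 with h | h
  · have := pow_le_one₀ (n := 2 * k) (abs_nonneg _) h
    have : 0 ≤ |Y ω| ^ (2 * r) := by positivity
    linarith
  · have := pow_le_pow_right₀ h (show 2 * k ≤ 2 * r by omega)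
    linarith

lemma memLp_signedPow {Y : Ω → ℝ} (hY : AEMeasurable Y P) {r : ℕ}
    (hint : Integrable (fun ω => |Y ω| ^ (2 * r)) P) :
    MemLp (fun ω => signedPow r (Y ω)) 2 P := by
  refine (memLp_abs_pow hY hint (Nat.sub_le r 1)).mono
    ((measurable_signedPow r).comp_aemeasurable hY).aestronglyMeasurable (ae_of_all _ fun ω => ?_)
  rw [Real.norm_eq_abs, Real.norm_of_nonneg (by positivity)]
  exact abs_signedPow_le r _

lemma integrable_signedPow_add {Y : Ω → ℝ} (hY : AEMeasurable Y P) {r : ℕ}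
    (hint : Integrable (fun ω => |Y ω| ^ (2 * r)) P) (h : ℝ) :
    Integrable (fun ω => signedPow r (Y ω + h)) P := by
  have hk : MemLp (fun ω => |Y ω| ^ (r - 1)) 2 P := memLp_abs_pow hY hint (Nat.sub_le r 1)
  have hb := (((hk.integrable (by norm_num)).add (integrable_const (|h| ^ (r - 1)))).const_mul
    (2 ^ (r - 1 - 1) : ℝ))
  refine hb.mono'
    ((measurable_signedPow r).comp_aemeasurable (hY.add_const h)).aestronglyMeasurable
    (ae_of_all _ fun ω => ?_)
  refine (abs_signedPow_le r _).trans ?_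
  refine (pow_le_pow_left₀ (abs_nonneg _) (abs_add_le _ _) _).trans ?_
  exact add_pow_le (abs_nonneg _) (abs_nonneg _) _

variable {Y : ℕ → Ω → ℝ} {Y₀ : Ω → ℝ}

lemma tendsto_integral_signedPow_increment (hY₀ : AEMeasurable Y₀ P) {r : ℕ} (hr : 1 ≤ r)
    (hint : Integrable (fun ω => |Y₀ ω| ^ (2 * r)) P) (hzero : r = 1 → ∀ᵐ ω ∂P, Y₀ ω ≠ 0)
    {M : ℝ} (hM : 0 < M) :
    Tendsto (fun n : ℕ => ∫ ω, signedPow r (Y₀ ω + M / √(n : ℝ))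
      - signedPow r (Y₀ ω - M / √(n : ℝ)) ∂P) atTop (𝓝 0) := by
  have hi (h : ℝ) := integrable_signedPow_add hY₀ hint h
  have hi' (h : ℝ) : Integrable (fun ω => signedPow r (Y₀ ω - h)) P := by
    simpa [sub_eq_add_neg] using hi (-h)
  have hlim : Tendsto (fun n : ℕ => M / √(n : ℝ)) atTop (𝓝 0) :=
    tendsto_const_nhds.div_atTop (Real.tendsto_sqrt_atTop.comp tendsto_natCast_atTop_atTop)
  have hmono := monotone_signedPow hr
  rw [show (0 : ℝ) = ∫ _ : Ω, (0 : ℝ) ∂P by simp]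
  refine tendsto_integral_filter_of_dominated_convergence
    -- By monotonicity the increment is largest at `n = 1`, which serves as the dominating function.
    (fun ω => signedPow r (Y₀ ω + M) - signedPow r (Y₀ ω - M))
    (Eventually.of_forall fun n => ((hi _).sub (hi' _)).aestronglyMeasurable) ?_
    ((hi M).sub (hi' M)) ?_
  · filter_upwards [eventually_ge_atTop 1] with n hn
    refine ae_of_all _ fun ω => ?_
    have h1 : M / √(n : ℝ) ≤ M := div_le_self hM.le (Real.one_le_sqrt.2 (by exact_mod_cast hn))
    have h0 : 0 ≤ M / √(n : ℝ) := by positivity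
    have e1 := hmono (show Y₀ ω - M / √(n : ℝ) ≤ Y₀ ω + M / √(n : ℝ) by linarith)
    have e2 := hmono (show Y₀ ω + M / √(n : ℝ) ≤ Y₀ ω + M by linarith)
    have e3 := hmono (show Y₀ ω - M ≤ Y₀ ω - M / √(n : ℝ) by linarith)
    rw [Real.norm_of_nonneg (by linarith)]
    linarith
  · have hne : ∀ᵐ ω ∂P, r = 1 → Y₀ ω ≠ 0 := by
      by_cases h : r = 1
      · filter_upwards [hzero h] with ω hω _ using hω
      · exact ae_of_all _ fun ω h' => absurd h' h
    filter_upwards [hne] with ω hω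
    have hc := continuousAt_signedPow hω hr
    have h1 : Tendsto (fun n : ℕ => Y₀ ω + M / √(n : ℝ)) atTop (𝓝 (Y₀ ω)) := by
      simpa using hlim.const_add (Y₀ ω)
    have h2 : Tendsto (fun n : ℕ => Y₀ ω - M / √(n : ℝ)) atTop (𝓝 (Y₀ ω)) := by
      simpa using hlim.const_sub (Y₀ ω)
    simpa using (hc.tendsto.comp h1).sub (hc.tendsto.comp h2)

/-- The summed linearization error is negligible at scale `√n` for shifts of order `1 / √n`. -/
lemma tendsto_measure_absPowRemainder (hident : ∀ k, IdentDistrib (Y k) Y₀ P P) {r : ℕ}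
    (hr : 1 ≤ r) (hint : Integrable (fun ω => |Y₀ ω| ^ (2 * r)) P)
    (hzero : r = 1 → ∀ᵐ ω ∂P, Y₀ ω ≠ 0) {H : ℕ → Ω → ℝ}
    (hH : IsTightSeq P fun n ω => √(n : ℝ) * H n ω) {ε : ℝ} (hε : 0 < ε) :
    Tendsto (fun n : ℕ => P.real {ω | ε ≤
      |(√(n : ℝ))⁻¹ * ∑ k ∈ Finset.range n, absPowRemainder r (Y k ω) (H n ω)|})
      atTop (𝓝 0) := by
  have hY₀ := (hident 0).aemeasurable_snd
  refine Metric.tendsto_atTop'.2 fun η hη => ?_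
  obtain ⟨M, hM, hMH⟩ := hH (η / 2) (by positivity)
  have hr0 : (0 : ℝ) < r := by exact_mod_cast hr
  have hlim := (tendsto_integral_signedPow_increment hY₀ hr hint hzero hM).const_mul (r * M / ε)
  rw [mul_zero] at hlim
  obtain ⟨n₀, hn₀⟩ := eventually_atTop.1 (hlim.eventually_lt_const (half_pos hη))
  refine ⟨n₀ + 1, fun n hn => ?_⟩
  rw [Real.dist_eq, sub_zero, abs_of_nonneg measureReal_nonneg]
  have hn1 : (0 : ℝ) < n := by exact_mod_cast (show 0 < n by omega)
  have hs : 0 < √(n : ℝ) := Real.sqrt_pos.2 hn1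
  set δ := M / √(n : ℝ) with hδ
  have hδ0 : 0 < δ := by positivity
  set f : ℝ → ℝ := fun x => signedPow r (x + δ) - signedPow r (x - δ) with hf
  have hf0 (x : ℝ) : 0 ≤ f x := sub_nonneg.2 (monotone_signedPow hr (by linarith))
  have hfm : Measurable f := ((measurable_signedPow r).comp (measurable_id.add_const δ)).sub
    ((measurable_signedPow r).comp (measurable_id.sub_const δ))
  have hfi : Integrable (f ∘ Y₀) P := by
    refine (integrable_signedPow_add hY₀ hint δ).sub ?_
    simpa [sub_eq_add_neg] using integrable_signedPow_add hY₀ hint (-δ)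
  have hfik k : Integrable (f ∘ Y k) P := ((hident k).comp hfm).integrable_iff.2 hfi
  -- On the event `|H| ≤ M / √n`, `G` bounds the normalized sum of remainders and no longer involves
  -- `H`, so Markov's inequality applies to it.
  set G : Ω → ℝ := fun ω => r * M / n * ∑ k ∈ Finset.range n, f (Y k ω) with hG
  have hGint : ∫ ω, G ω ∂P = r * M * ∫ ω, f (Y₀ ω) ∂P := by
    have hk k : ∫ ω, f (Y k ω) ∂P = ∫ ω, f (Y₀ ω) ∂P := ((hident k).comp hfm).integral_eq
    have hsum : ∫ ω, ∑ k ∈ Finset.range n, f (Y k ω) ∂P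
        = ∑ k ∈ Finset.range n, ∫ ω, f (Y k ω) ∂P := integral_finsetSum _ fun k _ => hfik k
    rw [integral_const_mul, hsum]
    simp only [hk, Finset.sum_const, Finset.card_range, nsmul_eq_mul]
    field_simp
  have hmarkov := mul_meas_ge_le_integral_of_nonneg (μ := P) (f := G)
    (ae_of_all _ fun ω => mul_nonneg (by positivity) (Finset.sum_nonneg fun k _ => hf0 _))
    ((integrable_finsetSum _ fun k _ => hfik k).const_mul _) ε
  have hsub : {ω | ε ≤ |(√(n : ℝ))⁻¹ * ∑ k ∈ Finset.range n, absPowRemainder r (Y k ω) (H n ω)|}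
      ⊆ {ω | M ≤ |√(n : ℝ) * H n ω|} ∪ {ω | ε ≤ G ω} := by
    intro ω hω
    by_cases h : M ≤ |√(n : ℝ) * H n ω|
    · exact Or.inl h
    right
    have hHδ : |H n ω| ≤ δ := by
      rw [abs_mul, abs_of_pos hs, not_le] at h
      rw [hδ, le_div_iff₀ hs, mul_comm]
      exact h.le
    refine le_trans (show ε ≤ _ from hω) ?_
    rw [abs_mul, abs_of_pos (inv_pos.2 hs)]
    calc (√(n : ℝ))⁻¹ * |∑ k ∈ Finset.range n, absPowRemainder r (Y k ω) (H n ω)|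
        ≤ (√(n : ℝ))⁻¹ * ∑ k ∈ Finset.range n, r * δ * f (Y k ω) := by
          gcongr
          refine (Finset.abs_sum_le_sum_abs _ _).trans (Finset.sum_le_sum fun k _ => ?_)
          exact abs_absPowRemainder_le hr _ hHδ
      _ = G ω := by
          rw [← Finset.mul_sum, hG, hδ, ← mul_assoc]
          congr 1
          have hn' : (n : ℝ) = √(n : ℝ) * √(n : ℝ) := (Real.mul_self_sqrt (by positivity)).symm
          conv_rhs => rw [hn']
          field_simp
  have h1 : P.real {ω | ε ≤ G ω} ≤ r * M / ε * ∫ ω, f (Y₀ ω) ∂P := by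
    rw [div_mul_eq_mul_div, le_div_iff₀ hε, mul_comm, ← hGint]
    exact hmarkov
  have h2 := hn₀ n (by omega)
  have h3 := (measureReal_mono hsub (μ := P)).trans (measureReal_union_le _ _)
  linarith [hMH n]

/-- A product of a tight sequence and one tending to zero in probability tends to zero. -/
lemma IsTightSeq.tendsto_measure_mul {U V : ℕ → Ω → ℝ} (hU : IsTightSeq P U)
    (hV : ∀ ε > 0, Tendsto (fun n => P.real {ω | ε ≤ |V n ω|}) atTop (𝓝 0))
    {ε : ℝ} (hε : 0 < ε) :
    Tendsto (fun n => P.real {ω | ε ≤ |U n ω * V n ω|}) atTop (𝓝 0) := by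
  refine Metric.tendsto_atTop'.2 fun η hη => ?_
  obtain ⟨M, hM, hMU⟩ := hU (η / 2) (by positivity)
  obtain ⟨n₀, hn₀⟩ := eventually_atTop.1
    ((hV (ε / M) (by positivity)).eventually_lt_const (half_pos hη))
  refine ⟨n₀, fun n hn => ?_⟩
  rw [Real.dist_eq, sub_zero, abs_of_nonneg measureReal_nonneg]
  have hsub : {ω | ε ≤ |U n ω * V n ω|} ⊆ {ω | M ≤ |U n ω|} ∪ {ω | ε / M ≤ |V n ω|} := by
    intro ω hω
    by_cases h : M ≤ |U n ω|
    · exact Or.inl h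
    right
    have hω' : ε ≤ |U n ω| * |V n ω| := by rw [← abs_mul]; exact hω
    rw [Set.mem_ofPred_eq, div_le_iff₀ hM]
    nlinarith [abs_nonneg (V n ω), not_le.1 h]
  have := (measureReal_mono hsub (μ := P)).trans (measureReal_union_le _ _)
  linarith [hMU n, hn₀ n hn.le]

lemma tendsto_measure_abs_add_abs {U V : ℕ → Ω → ℝ}
    (hU : ∀ ε > 0, Tendsto (fun n => P.real {ω | ε ≤ |U n ω|}) atTop (𝓝 0))
    (hV : ∀ ε > 0, Tendsto (fun n => P.real {ω | ε ≤ |V n ω|}) atTop (𝓝 0))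
    {ε : ℝ} (hε : 0 < ε) :
    Tendsto (fun n => P.real {ω | ε ≤ |U n ω| + |V n ω|}) atTop (𝓝 0) := by
  have h := (hU (ε / 2) (by positivity)).add (hV (ε / 2) (by positivity))
  rw [add_zero] at h
  refine squeeze_zero (fun _ => measureReal_nonneg) (fun n => ?_) h
  refine (measureReal_mono fun ω hω => ?_).trans (measureReal_union_le _ _)
  by_contra hcon
  simp only [Set.mem_union, Set.mem_ofPred_eq, not_or, not_le] at hcon hω
  linarith

lemma tendsto_measure_abs_add {U V : ℕ → Ω → ℝ}
    (hU : ∀ ε > 0, Tendsto (fun n => P.real {ω | ε ≤ |U n ω|}) atTop (𝓝 0))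
    (hV : ∀ ε > 0, Tendsto (fun n => P.real {ω | ε ≤ |V n ω|}) atTop (𝓝 0))
    {ε : ℝ} (hε : 0 < ε) :
    Tendsto (fun n => P.real {ω | ε ≤ |U n ω + V n ω|}) atTop (𝓝 0) := by
  refine squeeze_zero (fun _ => measureReal_nonneg) (fun n => ?_)
    (tendsto_measure_abs_add_abs hU hV hε)
  refine measureReal_mono fun ω hω => ?_
  have h : ε ≤ |U n ω + V n ω| := hω
  exact h.trans (abs_add_le (U n ω) (V n ω))

/-- Asymptotic linearization of the absolute centred sample moment of a centred iid sample. -/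
theorem tendsto_measure_sampleAbsCentredMoment_sub (hindep : iIndepFun Y P)
    (hident : ∀ k, IdentDistrib (Y k) Y₀ P P) {r : ℕ} (hr : 1 ≤ r)
    (hint : Integrable (fun ω => |Y₀ ω| ^ (2 * r)) P) (hL2 : MemLp Y₀ 2 P)
    (hmean : ∫ ω, Y₀ ω ∂P = 0)
    (hzero : r = 1 → ∀ᵐ ω ∂P, Y₀ ω ≠ 0) (m : ℝ) {ε : ℝ} (hε : 0 < ε) :
    Tendsto (fun n : ℕ => P.real {ω | ε ≤
      |√(n : ℝ) * (sampleAbsCentredMoment (fun i : Fin n => Y i ω) r - m)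
        - (√(n : ℝ))⁻¹ * ∑ k ∈ Finset.range n,
          (|Y k ω| ^ r - r * signedMoment P Y₀ r * Y k ω - m)|}) atTop (𝓝 0) := by
  have hY₀ := (hident 0).aemeasurable_snd
  set κ := signedMoment P Y₀ r with hκ
  have htight := isTightSeq_normalized_sum hindep hident hL2 hmean
  have hmeaneq (n : ℕ) (ω : Ω) : √(n : ℝ) * sampleMean (fun i : Fin n => Y i ω)
      = (√(n : ℝ))⁻¹ * ∑ k ∈ Finset.range n, Y k ω := by
    rw [sampleMean, Finset.sum_range, ← mul_assoc, mul_one_div, Real.sqrt_div_self', one_div]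
  have hH : IsTightSeq P fun n ω => √(n : ℝ) * sampleMean (fun i : Fin n => Y i ω) := by
    simpa only [hmeaneq] using htight
  have hR := fun ε (hε : ε > 0) =>
    tendsto_measure_absPowRemainder hident hr hint hzero hH (ε := ε) hε
  have hφm : Measurable fun x => signedPow r x - κ := (measurable_signedPow r).sub_const κ
  have hφ2 : MemLp (fun ω => signedPow r (Y₀ ω) - κ) 2 P :=
    (memLp_signedPow hY₀ hint).sub (memLp_const κ)
  have hφmean : ∫ ω, signedPow r (Y₀ ω) - κ ∂P = 0 := by
    rw [integral_sub ((memLp_signedPow hY₀ hint).integrable (by norm_num)) (integrable_const _)]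
    simp [hκ, signedMoment, signedPow]
  -- This factor replaces the empirical mean of `signedPow` by `κ`. Multiplied by the tight `√n`
  -- times the sample mean, it gives the part of the error not covered by `absPowRemainder`; the
  -- extra `1 / √n` makes it vanish by Chebyshev.
  have hφ (ε : ℝ) (hε : ε > 0) : Tendsto (fun n : ℕ => P.real {ω | ε ≤
      |-(r : ℝ) * (√(n : ℝ))⁻¹ * ((√(n : ℝ))⁻¹ * ∑ k ∈ Finset.range n, (signedPow r (Y k ω) - κ))|})
      atTop (𝓝 0) := by
    have hr0 : (0 : ℝ) < r := by exact_mod_cast hr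
    have hlim : Tendsto (fun n : ℕ => Var[fun ω => signedPow r (Y₀ ω) - κ; P]
        / (ε / r * √(n : ℝ)) ^ 2) atTop (𝓝 0) := by
      refine tendsto_const_nhds.div_atTop ((tendsto_pow_atTop two_ne_zero).comp ?_)
      exact (Real.tendsto_sqrt_atTop.comp tendsto_natCast_atTop_atTop).const_mul_atTop
        (by positivity)
    refine squeeze_zero' (Eventually.of_forall fun _ => measureReal_nonneg) ?_ hlim
    filter_upwards [eventually_ge_atTop 1] with n hn
    have hs : 0 < √(n : ℝ) := Real.sqrt_pos.2 (by exact_mod_cast hn)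
    refine le_trans (measureReal_mono fun ω hω => ?_) (measure_normalized_sum_ge_le
      (hindep.comp (fun _ => _) fun _ => hφm) (fun k => (hident k).comp hφm) hφ2 hφmean n
      (by positivity))
    have hω' := (show ε ≤ _ from hω)
    rw [abs_mul, abs_mul, abs_neg, abs_of_pos hr0, abs_of_pos (inv_pos.2 hs)] at hω'
    change ε / r * √(n : ℝ) ≤
      |(√(n : ℝ))⁻¹ * ∑ k ∈ Finset.range n, (signedPow r (Y k ω) - κ)|
    rw [div_mul_eq_mul_div, div_le_iff₀ hr0]
    calc ε * √(n : ℝ) ≤ (r * (√(n : ℝ))⁻¹ * |(√(n : ℝ))⁻¹ * ∑ k ∈ Finset.range n,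
          (signedPow r (Y k ω) - κ)|) * √(n : ℝ) := by gcongr
      _ = _ := by field_simp
  have hprod := fun ε (hε : ε > 0) => hH.tendsto_measure_mul hφ (ε := ε) hε
  have hsum := tendsto_measure_abs_add hR hprod hε
  refine hsum.congr fun n => ?_
  congr 2
  ext ω
  congr! 2
  rcases n.eq_zero_or_pos with rfl | hn
  · simp
  have hn0 : (0 : ℝ) < n := by exact_mod_cast hn
  have hs : 0 < √(n : ℝ) := Real.sqrt_pos.2 hn0
  have hn' : (n : ℝ) = √(n : ℝ) * √(n : ℝ) := (Real.mul_self_sqrt (by positivity)).symm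
  have hS := hmeaneq n ω
  have hB : sampleAbsCentredMoment (fun i : Fin n => Y i ω) r = (1 / (n : ℝ)) *
      ∑ k ∈ Finset.range n, |Y k ω - sampleMean (fun i : Fin n => Y i ω)| ^ r := by
    rw [sampleAbsCentredMoment, Finset.sum_range]
  rw [hB]
  simp only [absPowRemainder, Finset.sum_add_distrib, Finset.sum_sub_distrib, ← Finset.mul_sum,
    Finset.sum_const, Finset.card_range, nsmul_eq_mul]
  generalize sampleMean (fun i : Fin n => Y i ω) = h at *
  generalize ∑ k ∈ Finset.range n, |Y k ω - h| ^ r = B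
  generalize ∑ k ∈ Finset.range n, |Y k ω| ^ r = A
  generalize ∑ k ∈ Finset.range n, signedPow r (Y k ω) = Φ
  generalize ∑ k ∈ Finset.range n, Y k ω = S at *
  have hS' : S = √(n : ℝ) * (√(n : ℝ) * h) := by rw [hS]; field_simp
  rw [hS']
  generalize √(n : ℝ) = s at *
  rw [hn']
  field_simp
  ring

end Moments

/-! ### Influence functions, their covariance and the joint limit -/

section JointLimit

/-- The mass of a point is the jump of the distribution function there. -/
lemma ae_ne_of_continuousAt_distFun {Y : Ω → ℝ} (hY : AEMeasurable Y P) {x : ℝ}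
    (hcont : ContinuousAt (distFun P Y) x) : ∀ᵐ ω ∂P, Y ω ≠ x := by
  have := Measure.isProbabilityMeasure_map hY
  have hx : P.map Y {x} = 0 := by
    have hc : ContinuousAt (cdf (P.map Y)) x := hcont
    have h := StieltjesFunction.measure_singleton (cdf (P.map Y)) x
    rw [measure_cdf, ((monotone_cdf _).continuousAt_iff_leftLim_eq_rightLim.1 hc),
      StieltjesFunction.rightLim_eq, sub_self, ENNReal.ofReal_zero] at h
    exact h
  exact ae_of_ae_map hY (compl_mem_ae_iff.2 hx)

/-- The pair of influence functions of the `p`-quantile and of the `r`-th absolute centred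
moment. -/
noncomputable def influence (q p d κ m : ℝ) (r : ℕ) (x : ℝ) : EuclideanSpace ℝ (Fin 2) :=
  !₂[-((Set.Iic q).indicator (fun _ => (1 : ℝ)) x - p) / d, |x| ^ r - r * κ * x - m]

lemma measurable_vec2 {α : Type*} [MeasurableSpace α] {f g : α → ℝ} (hf : Measurable f)
    (hg : Measurable g) : Measurable fun x => (!₂[f x, g x] : EuclideanSpace ℝ (Fin 2)) := by
  refine (WithLp.measurable_toLp 2 (Fin 2 → ℝ)).comp (measurable_pi_iff.2 fun i => ?_)
  fin_cases i
  · exact hf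
  · exact hg

lemma measurable_influence (q p d κ m : ℝ) (r : ℕ) : Measurable (influence q p d κ m r) :=
  measurable_vec2 (((measurable_indicator_Iic q).sub_const p).neg.div_const d) (by fun_prop)

lemma norm_le_abs_add_abs (x : EuclideanSpace ℝ (Fin 2)) : ‖x‖ ≤ |x 0| + |x 1| := by
  rw [EuclideanSpace.norm_eq, Fin.sum_univ_two]
  refine Real.sqrt_le_iff.2 ⟨by positivity, ?_⟩
  simp only [Real.norm_eq_abs]
  nlinarith [mul_nonneg (abs_nonneg (x 0)) (abs_nonneg (x 1))]

lemma measurable_sampleAbsCentredMoment (n r : ℕ) :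
    Measurable fun x : Fin n → ℝ => sampleAbsCentredMoment x r := by
  unfold sampleAbsCentredMoment sampleMean
  fun_prop

variable {Y₀ : Ω → ℝ}

lemma variance_indLe (hY₀ : AEMeasurable Y₀ P) (q : ℝ) :
    cov[indLe Y₀ q, indLe Y₀ q; P] = distFun P Y₀ q * (1 - distFun P Y₀ q) := by
  have h2 : MemLp (indLe Y₀ q) 2 P := memLp_indicator_Iic hY₀ q
  have hsq : indLe Y₀ q * indLe Y₀ q = indLe Y₀ q := by
    ext ω
    by_cases h : Y₀ ω ≤ q <;> simp [indLe, h]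
  have hE : ∫ ω, indLe Y₀ q ω ∂P = distFun P Y₀ q := integral_indicator_Iic hY₀ q
  rw [covariance_eq_sub h2 h2, hsq, hE]
  ring

lemma gammaMatrix_eq_covariance (hY₀ : AEMeasurable Y₀ P) {r : ℕ} {p v d : ℝ}
    (hint : Integrable (fun ω => |Y₀ ω| ^ (2 * r)) P) (hL2 : MemLp Y₀ 2 P)
    (hvar : Var[Y₀; P] = v) (hd : density P Y₀ (quantile P Y₀ p) = d)
    (hFq : distFun P Y₀ (quantile P Y₀ p) = p) (m : ℝ) :
    gammaMatrix P Y₀ v p r = Matrix.of fun i j =>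
      cov[fun ω => influence (quantile P Y₀ p) p d (signedMoment P Y₀ r) m r (Y₀ ω) i,
        fun ω => influence (quantile P Y₀ p) p d (signedMoment P Y₀ r) m r (Y₀ ω) j; P] := by
  set q := quantile P Y₀ p with hq
  set κ := signedMoment P Y₀ r with hκ
  have hI : MemLp (indLe Y₀ q) 2 P := memLp_indicator_Iic hY₀ q
  have hA : MemLp (fun ω => |Y₀ ω| ^ r) 2 P := memLp_abs_pow hY₀ hint le_rfl
  have hK : MemLp (fun ω => r * κ * Y₀ ω) 2 P := hL2.const_mul _
  have hAK : MemLp (fun ω => |Y₀ ω| ^ r - r * κ * Y₀ ω) 2 P := hA.sub hK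
  have e0 : (fun ω => influence q p d κ m r (Y₀ ω) 0)
      = fun ω => -d⁻¹ * (indLe Y₀ q ω - p) := by
    ext ω
    change -(indLe Y₀ q ω - p) / d = _
    ring
  have e1 : (fun ω => influence q p d κ m r (Y₀ ω) 1)
      = fun ω => (|Y₀ ω| ^ r - r * κ * Y₀ ω) - m := rfl
  have hi (W : Ω → ℝ) (hW : MemLp W 2 P) : Integrable W P := hW.integrable (by norm_num)
  have c00 : cov[fun ω => influence q p d κ m r (Y₀ ω) 0,
      fun ω => influence q p d κ m r (Y₀ ω) 0; P] = gamma11 P Y₀ p := by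
    rw [e0, covariance_const_mul_left, covariance_const_mul_right,
      covariance_sub_const_left (hi _ hI), covariance_sub_const_right (hi _ hI),
      variance_indLe hY₀, hFq, gamma11, ← hq, hd]
    field_simp
  have c01 : cov[fun ω => influence q p d κ m r (Y₀ ω) 0,
      fun ω => influence q p d κ m r (Y₀ ω) 1; P] = gamma12 P Y₀ p r := by
    rw [e0, e1, covariance_const_mul_left,
      covariance_sub_const_left (hi _ hI), covariance_sub_const_right (hi _ hAK),
      covariance_fun_sub_right hI hA hK, covariance_const_mul_right, gamma12, ← hq, hd]
    ring
  have c11 : cov[fun ω => influence q p d κ m r (Y₀ ω) 1,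
      fun ω => influence q p d κ m r (Y₀ ω) 1; P] = gamma22 P Y₀ v r := by
    rw [e1, covariance_sub_const_left (hi _ hAK), covariance_sub_const_right (hi _ hAK),
      covariance_fun_sub_right hAK hA hK, covariance_fun_sub_left hA hK hA,
      covariance_fun_sub_left hA hK hK, covariance_const_mul_left, covariance_const_mul_left,
      covariance_const_mul_right, covariance_const_mul_right, covariance_self hL2.aemeasurable,
      covariance_self hA.aemeasurable, hvar, covariance_comm (fun ω => |Y₀ ω| ^ r) Y₀, gamma22]
    ring
  ext i j
  fin_cases i <;> fin_cases j
  · exact c00.symm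
  · exact c01.symm
  · exact (c01.symm.trans (covariance_comm _ _))
  · exact c11.symm

/-- Joint central limit theorem for the sample quantile and the absolute centred sample moment of a
centred iid sequence. -/
theorem tendstoInDistribution_quantile_moment {Y : ℕ → Ω → ℝ} (hY : ∀ k, Measurable (Y k))
    (hindep : iIndepFun Y P) (hident : ∀ k, IdentDistrib (Y k) Y₀ P P) {r : ℕ} (hr : 1 ≤ r)
    {p v : ℝ} (hp : p ∈ Set.Ioo (0 : ℝ) 1)
    (hint : Integrable (fun ω => |Y₀ ω| ^ (2 * r)) P) (hL2 : MemLp Y₀ 2 P)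
    (hmean : ∫ ω, Y₀ ω ∂P = 0) (hvar : Var[Y₀; P] = v)
    (hC0 : r = 1 → ContinuousAt (distFun P Y₀) 0)
    (hdiff : DifferentiableAt ℝ (distFun P Y₀) (quantile P Y₀ p))
    (hpos : 0 < density P Y₀ (quantile P Y₀ p)) :
    (gammaMatrix P Y₀ v p r).PosSemidef ∧
    TendstoInDistribution
      (fun (n : ℕ) (ω : Ω) =>
        (!₂[√(n : ℝ) * (sampleQuantile (fun i : Fin n => Y i ω) p - quantile P Y₀ p),
            √(n : ℝ) * (sampleAbsCentredMoment (fun i : Fin n => Y i ω) r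
              - absCentredMoment P Y₀ r)] : EuclideanSpace ℝ (Fin 2)))
      atTop (fun z : EuclideanSpace ℝ (Fin 2) => z) (fun _ => P)
      (multivariateGaussian (0 : EuclideanSpace ℝ (Fin 2)) (gammaMatrix P Y₀ v p r)) := by
  have hY₀ := (hident 0).aemeasurable_snd
  have hFq := distFun_quantile hp hdiff.continuousAt
  have hzero (h : r = 1) : ∀ᵐ ω ∂P, Y₀ ω ≠ 0 := ae_ne_of_continuousAt_distFun hY₀ (hC0 h)
  set q := quantile P Y₀ p with hq
  set d := density P Y₀ q with hd
  set κ := signedMoment P Y₀ r with hκ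
  set m := absCentredMoment P Y₀ r with hm
  have hm' : m = ∫ ω, |Y₀ ω| ^ r ∂P := by simp [hm, absCentredMoment, hmean]
  have hderiv : HasDerivAt (distFun P Y₀) d q := hdiff.hasDerivAt
  have hΓ := gammaMatrix_eq_covariance hY₀ hint hL2 hvar hd.symm hFq m
  rw [← hq, ← hκ] at hΓ
  set F := influence q p d κ m r with hF
  have hFm : Measurable F := measurable_influence q p d κ m r
  have hI : MemLp (fun ω => (Set.Iic q).indicator (fun _ => (1 : ℝ)) (Y₀ ω)) 2 P :=
    memLp_indicator_Iic hY₀ q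
  have hA : MemLp (fun ω => |Y₀ ω| ^ r) 2 P := memLp_abs_pow hY₀ hint le_rfl
  have hF2 (i : Fin 2) : MemLp (fun ω => F (Y₀ ω) i) 2 P := by
    fin_cases i
    · change MemLp (fun ω => -((Set.Iic q).indicator (fun _ => (1 : ℝ)) (Y₀ ω) - p) / d) 2 P
      simp only [div_eq_mul_inv]
      exact ((hI.sub (memLp_const p)).neg).mul_const d⁻¹
    · exact (hA.sub (hL2.const_mul (r * κ))).sub (memLp_const m)
  have hFmean (i : Fin 2) : ∫ ω, F (Y₀ ω) i ∂P = 0 := by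
    fin_cases i
    · change ∫ ω, -((Set.Iic q).indicator (fun _ => (1 : ℝ)) (Y₀ ω) - p) / d ∂P = 0
      rw [integral_div, integral_neg, integral_sub (hI.integrable (by norm_num))
        (integrable_const _), integral_indicator_Iic hY₀, hFq]
      simp
    · change ∫ ω, |Y₀ ω| ^ r - r * κ * Y₀ ω - m ∂P = 0
      have hAi := hA.integrable (q := 2) (by norm_num)
      have hKi := (hL2.integrable (by norm_num)).const_mul (r * κ)
      have h1 : Integrable (fun ω => |Y₀ ω| ^ r - r * κ * Y₀ ω) P := hAi.sub hKi
      rw [integral_sub h1 (integrable_const _), integral_sub hAi hKi, integral_const_mul, hmean, hm']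
      simp
  have hclt := tendstoInDistribution_multivariateGaussian (Z := fun k ω => F (Y k ω))
    (Z₀ := fun ω => F (Y₀ ω)) (hindep.comp (fun _ => F) fun _ => hFm)
    (fun k => (hident k).comp hFm) hF2 hFmean
  refine ⟨hΓ ▸ posSemidef_covariance hF2, ?_⟩
  rw [hΓ]
  -- Slutsky: the two coordinate errors vanish in probability, so the statistics inherit the limit
  -- of the normalized influence sums.
  refine tendstoInDistribution_of_tendstoInMeasure_sub _ _ hclt ?_ fun n => ?_
  · rw [tendstoInMeasure_iff_measureReal_norm]
    intro ε hε
    have hU := fun ε (hε : ε > 0) =>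
      tendsto_measure_sampleQuantile_sub hindep hident hp hderiv hFq hpos hε
    have hV := fun ε (hε : ε > 0) =>
      tendsto_measure_sampleAbsCentredMoment_sub hindep hident hr hint hL2 hmean hzero m hε
    refine squeeze_zero (fun _ => measureReal_nonneg) (fun n => ?_)
      (tendsto_measure_abs_add_abs hU hV hε)
    refine measureReal_mono fun ω hω => ?_
    refine le_trans (le_trans (show ε ≤ _ from hω) (norm_le_abs_add_abs _)) ?_
    simp [hF, influence, hκ]
  · have hs : Measurable fun ω (i : Fin n) => Y i ω := measurable_pi_iff.2 fun i => hY i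
    exact (measurable_vec2
      ((((measurable_sampleQuantile hp n).comp hs).sub_const q).const_mul _)
      ((((measurable_sampleAbsCentredMoment n r).comp hs).sub_const m).const_mul _)).aemeasurable

end JointLimit

/-! ### From the augmented GARCH process to an iid sample -/

omit [IsProbabilityMeasure P] in
/-- An augmented GARCH process with constant volatility is a multiple of its innovations. -/
lemma IsAugmentedGARCH.ae_eq_sqrt_mul {a b : ℕ} {Λ : ℝ → ℝ} {g c : ℕ → ℝ → ℝ} {ε σ X : ℤ → Ω → ℝ}
    (hX : IsAugmentedGARCH P a b Λ g c ε σ X) {v : ℝ} (hconst : ∀ t, ∀ᵐ ω ∂P, σ t ω ^ 2 = v)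
    (t : ℤ) : (fun ω => √v * ε t ω) =ᵐ[P] X t := by
  filter_upwards [hX.process_eq t, hX.volatility_nonneg t, hconst t] with ω h1 h2 h3
  rw [h1, ← h3, Real.sqrt_sq h2]

end AugGARCH

theorem corollary2 {Ω : Type*} [MeasurableSpace Ω] (P : Measure Ω) [IsProbabilityMeasure P]
    (a b : ℕ) (Λ : ℝ → ℝ) (g c : ℕ → ℝ → ℝ) (ε σ X : ℤ → Ω → ℝ)
    (hX : AugGARCH.IsAugmentedGARCH P a b Λ g c ε σ X)
    (v : ℝ) (hv : 0 < v) (hconst : ∀ t, ∀ᵐ ω ∂P, σ t ω ^ 2 = v)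
    (r : ℕ) (hr : 1 ≤ r) (p : ℝ) (hp : p ∈ Set.Ioo (0 : ℝ) 1)
    (hC0 : r = 1 → ContinuousAt (AugGARCH.distFun P (X 0)) 0)
    (hC2 : AugGARCH.TwiceDifferentiableAt (AugGARCH.distFun P (X 0))
      (AugGARCH.quantile P (X 0) p))
    (hpos : 0 < AugGARCH.density P (X 0) (AugGARCH.quantile P (X 0) p))
    (hM : AugGARCH.CondM P ε r) (hA : AugGARCH.CondA a b g c)
    (hLee : (∃ δ : ℝ, AugGARCH.IsPolynomial Λ δ ∧
        AugGARCH.CondP P a b g c ε (max 1 ((r : ℝ) / δ))) ∨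
      (AugGARCH.IsExponential Λ ∧ AugGARCH.CondL P a b g c ε r)) :
    (iIndepFun X P ∧ ∀ t, IdentDistrib (X t) (X 0) P P) ∧
    (AugGARCH.gammaMatrix P (X 0) v p r).PosSemidef ∧
    TendstoInDistribution
      (fun (n : ℕ) (ω : Ω) =>
        (!₂[√(n : ℝ) * (AugGARCH.sampleQuantile (AugGARCH.sample X n ω) p
              - AugGARCH.quantile P (X 0) p),
            √(n : ℝ) * (AugGARCH.sampleAbsCentredMoment (AugGARCH.sample X n ω) r
              - AugGARCH.absCentredMoment P (X 0) r)] : EuclideanSpace ℝ (Fin 2)))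
      atTop (fun z : EuclideanSpace ℝ (Fin 2) => z) (fun _ => P)
      (multivariateGaussian (0 : EuclideanSpace ℝ (Fin 2))
        (AugGARCH.gammaMatrix P (X 0) v p r)) := by
  have hae := hX.ae_eq_sqrt_mul hconst
  have hscale : Measurable fun x : ℝ => √v * x := measurable_const_mul _
  have hindep : iIndepFun X P :=
    (hX.indep_innovation.comp (fun _ x => √v * x) fun _ => hscale).congr hae
  have hεX (t : ℤ) : IdentDistrib (fun ω => √v * ε t ω) (X t) P P :=
    IdentDistrib.of_ae_eq ((hX.measurable_innovation t).const_mul _).aemeasurable (hae t)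
  have hident (t : ℤ) : IdentDistrib (X t) (X 0) P P :=
    ((hεX t).symm.trans ((hX.identDistrib_innovation t).comp hscale)).trans (hεX 0)
  refine ⟨⟨hindep, hident⟩, ?_⟩
  have hL2 : MemLp (X 0) 2 P := (hX.memLp_innovation.const_mul (√v)).ae_eq (hae 0)
  have hmean : ∫ ω, X 0 ω ∂P = 0 := by
    rw [← integral_congr_ae (hae 0), integral_const_mul, hX.mean_innovation, mul_zero]
  have hvar : Var[X 0; P] = v := by
    rw [← variance_congr (hae 0), variance_const_mul, hX.variance_innovation, mul_one,
      Real.sq_sqrt hv.le]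
  have hint : Integrable (fun ω => |X 0 ω| ^ (2 * r)) P := by
    have hM' : Integrable (fun ω => |ε 0 ω| ^ (2 * r)) P := hM
    refine (hM'.const_mul (√v ^ (2 * r))).congr ?_
    filter_upwards [hae 0] with ω hω
    rw [← hω, abs_mul, mul_pow, abs_of_nonneg (Real.sqrt_nonneg v)]
  -- The sample is `X 1, …, X n`, so the two-sided process is restricted along `k ↦ k + 1`;
  -- injectivity preserves independence.
  have hinj : Function.Injective fun k : ℕ => (k : ℤ) + 1 := fun i j h => by
    simpa using h
  exact AugGARCH.tendstoInDistribution_quantile_moment (Y := fun k : ℕ => X ((k : ℤ) + 1))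
    (fun k => hX.measurable_process _) (hindep.precomp hinj) (fun k => hident _) hr hp hint hL2
    hmean hvar hC0 hC2.1.self_of_nhds hpos
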